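/- Let $d\ge 1$ be an integer, let $\mu>-\tfrac12$, $\gamma>-1$ and $n\in\{0,1,2,\dots\}$. On the solid cone $\mathbb V^{d+1}=\{(x,t)\in\mathbb R^d\times\mathbb R:\ \|x\|\le t\le 1\}$, where $\|\cdot\|$ is the Euclidean norm, consider the weight $$W_{\mu,\gamma}(x,t)=(t^2-\|x\|^2)^{\mu-\frac12}(1-t)^{\gamma}$$ and the inner product $$\langle f,g\rangle_{\mu,\gamma}=b_{\mu,\gamma}\int_{\mathbb V^{d+1}}f(x,t)\,g(x,t)\,W_{\mu,\gamma}(x,t)\,\mathrm dx\,\mathrm dt,\qquad b_{\mu,\gamma}=\Big(\int_{\mathbb V^{d+1}}W_{\mu,\gamma}(x,t)\,\mathrm dx\,\mathrm dt\Big)^{-1},$$ so that $\langle 1,1\rangle_{\mu,\gamma}=1$. Let $\mathcal V_n(\mathbb V^{d+1},W_{\mu,\gamma})$ be the set of all real polynomials $u$ in the $d+1$ variables $(x,t)=(x_1,\dots,x_d,t)$ of total degree at most $n$ such that $\langle u,q\rangle_{\mu,\gamma}=0$ for every polynomial $q$ of total degree at most $n-1$ (no condition if $n=0$). Define the second order linear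 differential operator $$\begin{aligned}\mathcal D_{\mu,\gamma}={}& t(1-t)\,\partial_t^2+2(1-t)\,\langle x,\nabla_x\rangle\,\partial_t+\sum_{i=1}^d(t-x_i^2)\,\partial_{x_i}^2-2\sum_{1\le i<j\le d}x_ix_j\,\partial_{x_i}\partial_{x_j}\\&+(2\mu+d)\,\partial_t-(2\mu+\gamma+d+1)\big(\langle x,\nabla_x\rangle+t\,\partial_t\big),\end{aligned}$$ where $\langle x,\nabla_x\rangle=\sum_{i=1}^d x_i\,\partial_{x_i}$. Then every $u\in\mathcal V_n(\mathbb V^{d+1},W_{\mu,\gamma})$ satisfies $$\mathcal D_{\mu,\gamma}u=-n(n+2\mu+\gamma+d)\,u.$$ -/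

import Mathlib

open MeasureTheory

noncomputable section

namespace SolidCone

/-- Real polynomials in the `d + 1` variables `(x, t) = (x₁, …, x_d, t)`:
the variable `x i` is indexed by `some i`, the variable `t` by `none`. -/
abbrev Poly (d : ℕ) : Type := MvPolynomial (Option (Fin d)) ℝ

/-- The value of the polynomial `p` at the point `(x, t)`, `x ∈ ℝ^d`, `t ∈ ℝ`. -/
def evalAt {d : ℕ} (p : Poly d) (z : EuclideanSpace ℝ (Fin d) × ℝ) : ℝ :=
  MvPolynomial.eval (fun j : Option (Fin d) => j.elim z.2 (fun i => z.1 i)) p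

/-- The solid cone `{(x, t) : ‖x‖ ≤ t ≤ 1}` in `ℝ^d × ℝ`, with `‖·‖` the Euclidean norm. -/
def cone (d : ℕ) : Set (EuclideanSpace ℝ (Fin d) × ℝ) :=
  {z | ‖z.1‖ ≤ z.2 ∧ z.2 ≤ 1}

/-- The weight `W(x, t) = (t² - ‖x‖²)^(μ - 1/2) (1 - t)^γ`. -/
def weight {d : ℕ} (μ γ : ℝ) (z : EuclideanSpace ℝ (Fin d) × ℝ) : ℝ :=
  (z.2 ^ 2 - ‖z.1‖ ^ 2) ^ (μ - 1 / 2) * (1 - z.2) ^ γ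

/-- The normalization constant of the inner product, so that `⟨1, 1⟩ = 1`. -/
def normConst (d : ℕ) (μ γ : ℝ) : ℝ :=
  (∫ z in cone d, weight μ γ z)⁻¹

/-- The normalized inner product of two polynomials with respect to the weight on the cone
(integration is against Lebesgue measure `dx dt`). -/
def innerProd {d : ℕ} (μ γ : ℝ) (p q : Poly d) : ℝ :=
  normConst d μ γ * ∫ z in cone d, evalAt p z * evalAt q z * weight μ γ z

/-- The orthogonal polynomials of degree `n`: the polynomials of total degree at most `n` that
are orthogonal to all polynomials of total degree at most `n - 1`, i.e. less than `n`.
For `n = 0` the orthogonality condition is empty. -/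
def orthogonalPolynomials (d : ℕ) (μ γ : ℝ) (n : ℕ) : Set (Poly d) :=
  {p | p.totalDegree ≤ n ∧ ∀ q : Poly d, q.totalDegree < n → innerProd μ γ p q = 0}

/-- The coordinate polynomial `x_i`. -/
def varX {d : ℕ} (i : Fin d) : Poly d := MvPolynomial.X (some i)

/-- The coordinate polynomial `t`. -/
def varT {d : ℕ} : Poly d := MvPolynomial.X none

/-- The partial derivative `∂/∂x_i` on polynomials. -/
def dX {d : ℕ} (i : Fin d) : Poly d →ₗ[ℝ] Poly d := (MvPolynomial.pderiv (some i)).toLinearMap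

/-- The partial derivative `∂/∂t` on polynomials. -/
def dT {d : ℕ} : Poly d →ₗ[ℝ] Poly d := (MvPolynomial.pderiv none).toLinearMap

/-- The operator `⟨x, ∇_x⟩ = ∑ i, x_i ∂/∂x_i`. -/
def xGrad {d : ℕ} (u : Poly d) : Poly d := ∑ i, varX i * dX i u

/-- The second order linear differential operator `D_{μ,γ}` on polynomials. -/
def diffOp (d : ℕ) (μ γ : ℝ) : Poly d →ₗ[ℝ] Poly d where
  toFun u :=
    varT * (1 - varT) * dT (dT u)
      + 2 * (1 - varT) * xGrad (dT u)
      + ∑ i, (varT - varX i ^ 2) * dX i (dX i u)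
      - 2 * ∑ i, ∑ j ∈ Finset.Ioi i, varX i * varX j * dX i (dX j u)
      + (2 * μ + d) • dT u
      - (2 * μ + γ + d + 1) • (xGrad u + varT * dT u)
  map_add' u v := by
    simp only [xGrad, map_add, mul_add, smul_add, Finset.sum_add_distrib]
    abel
  map_smul' c u := by
    simp only [xGrad, map_smul, mul_smul_comm, ← Finset.smul_sum, smul_add, smul_sub,
      RingHom.id_apply]
    simp only [smul_comm c]

end SolidCone

end

/-!
The operator `D = diffOp d μ γ` is symmetric for the functional `L p = ∫ p W`, and it is triangular
with respect to the degree, acting as `-n (n + 2μ + γ + d)` modulo lower degree. If `u` has degree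
at most `n` and is orthogonal to all lower degrees, then `v = D u + n (n + 2μ + γ + d) u` has degree
less than `n`, so `L (v v) = L (u (D v)) + n (n + 2μ + γ + d) L (u v) = 0` by symmetry and
orthogonality, and `v = 0` because `W` is positive inside the cone
(`IsConeFunctional.diffOp_eq_of_orthogonal`, `coneFunctional_sq_eq_zero`).

Symmetry amounts to `L (q (D p)) = -L (Γ(p, q))` with `Γ` symmetric
(`IsConeFunctional.diffOp_mul`), which is integration by parts for the columns of the second order
coefficients, the vector fields `(1 - t) E` and `t ∂_i + x_i ∂_t - x_i E`, where
`E = ⟨x, ∇_x⟩ + t ∂_t`. For `μ < 1/2` the weight is unbounded at the lateral boundary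
`s = t² - ‖x‖² = 0`, and the divergence theorem does not apply to these fields directly. They are
instead reduced to the fields `s ∂_i` and `s (1 - t) ∂_t`, for which the fundamental theorem of
calculus on coordinate lines is enough, since `s ^ (μ + 1/2)` is continuous and vanishes at the
boundary (`coneFunctional_varX_mul`, `coneFunctional_varT_mul`). As `x_i W` and `t (1 - t) W` are,
up to constant factors and a multiple of `s W`, derivatives of `s ^ (μ + 1/2)` times a power of
`1 - t`, a further integration by parts makes the mixed second derivatives cancel in rotations and
Lorentz boosts. These generate the fields `t ∂_i + x_i ∂_t - x_i E`, and `(1 - t) E` tested against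
polynomials vanishing at the apex. What remains is `(1 - t) E` tested against `1`, which is the
recursion of the Beta integral (`coneFunctional_one`).
-/

noncomputable section

namespace SolidCone

variable {d : ℕ}

section Algebra

open MvPolynomial

/-! ### Vector fields on polynomials -/

theorem dX_apply (i : Fin d) (p : Poly d) : dX i p = pderiv (some i) p := rfl

theorem dT_apply (p : Poly d) : dT p = pderiv none p := rfl

theorem pderiv_pderiv_comm {σ R : Type*} [CommRing R] (i j : σ) (p : MvPolynomial σ R) :
    pderiv i (pderiv j p) = pderiv j (pderiv i p) := by
  classical
  have h : ⁅pderiv (R := R) i, pderiv (R := R) j⁆ = 0 := by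
    refine derivation_ext fun k => ?_
    rw [Derivation.commutator_apply, pderiv_X, pderiv_X, Pi.single_apply, Pi.single_apply]
    split_ifs <;> simp
  have := DFunLike.congr_fun h p
  rwa [Derivation.commutator_apply, Derivation.zero_apply, sub_eq_zero] at this

theorem dX_mul (i : Fin d) (p q : Poly d) : dX i (p * q) = dX i p * q + p * dX i q := by
  rw [dX_apply, Derivation.leibniz, smul_eq_mul, smul_eq_mul, dX_apply, dX_apply]
  ring

theorem dT_mul (p q : Poly d) : dT (p * q) = dT p * q + p * dT q := by
  rw [dT_apply, Derivation.leibniz, smul_eq_mul, smul_eq_mul, dT_apply, dT_apply]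
  ring

@[simp] theorem dX_varX (i j : Fin d) : dX i (varX j) = if i = j then 1 else 0 := by
  simp only [dX_apply, varX, pderiv_X, Pi.single_apply, Option.some_inj, eq_comm]

@[simp] theorem dX_varT (i : Fin d) : dX i varT = 0 := by
  simp [dX, varT, pderiv_X]

@[simp] theorem dT_varT : dT (varT : Poly d) = 1 := by
  simp [dT, varT, pderiv_X]

@[simp] theorem dT_varX (i : Fin d) : dT (varX i) = 0 := by
  simp [dT, varX, pderiv_X]

@[simp] theorem dX_one (i : Fin d) : dX i (1 : Poly d) = 0 := by simp [dX]

@[simp] theorem dT_one : dT (1 : Poly d) = 0 := by simp [dT]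

theorem dX_dX_comm (i j : Fin d) (p : Poly d) : dX i (dX j p) = dX j (dX i p) :=
  pderiv_pderiv_comm ..

theorem dT_dX_comm (i : Fin d) (p : Poly d) : dT (dX i p) = dX i (dT p) :=
  pderiv_pderiv_comm ..

/-- The Lorentz form `t² - ‖x‖²`, whose power is the first factor of the weight. -/
def lorentz (d : ℕ) : Poly d := varT ^ 2 - ∑ i, varX i ^ 2

/-- The Euler operator `⟨x, ∇_x⟩ + t ∂_t`. -/
def euler (p : Poly d) : Poly d := xGrad p + varT * dT p

/-- The Lorentz boost `t ∂_{x_i} + x_i ∂_t`, a vector field tangent to the cone `t² = ‖x‖²`. -/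
def boost (i : Fin d) (p : Poly d) : Poly d := varT * dX i p + varX i * dT p

theorem xGrad_mul (p q : Poly d) : xGrad (p * q) = xGrad p * q + p * xGrad q := by
  simp only [xGrad, dX_mul, Finset.sum_mul, Finset.mul_sum, ← Finset.sum_add_distrib]
  exact Finset.sum_congr rfl fun i _ => by ring

theorem euler_mul (p q : Poly d) : euler (p * q) = euler p * q + p * euler q := by
  simp only [euler, xGrad_mul, dT_mul]; ring

@[simp] theorem euler_varT : euler (varT : Poly d) = varT := by simp [euler, xGrad]

@[simp] theorem euler_varX (i : Fin d) : euler (varX i) = varX i := by simp [euler, xGrad]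

@[simp] theorem euler_one : euler (1 : Poly d) = 0 := by simp [euler, xGrad]

theorem euler_add (p q : Poly d) : euler (p + q) = euler p + euler q := by
  simp only [euler, xGrad, map_add, mul_add, Finset.sum_add_distrib]; ring

theorem euler_smul (c : ℝ) (p : Poly d) : euler (c • p) = c • euler p := by
  simp only [euler, xGrad, map_smul, mul_smul_comm, smul_add, Finset.smul_sum]

theorem boost_mul (i : Fin d) (p q : Poly d) :
    boost i (p * q) = boost i p * q + p * boost i q := by
  simp only [boost, dX_mul, dT_mul]; ring

/-- The form of linearity matching polynomial identities checked by `ring`, where scalars are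
constant polynomials. -/
theorem linearMap_C_mul (L : Poly d →ₗ[ℝ] ℝ) (c : ℝ) (p : Poly d) : L (C c * p) = c * L p := by
  rw [← smul_eq_C_mul, map_smul, smul_eq_mul]

/-! ### Integration by parts from the coordinate directions -/

/-- The integration by parts identities of the functional `p ↦ ∫ p W` on the solid cone: those
along the coordinate lines, for the fields `s ∂_{x_i}` and `s (1 - t) ∂_t` with `s = t² - ‖x‖²`,
and the one for the field `(1 - t) (⟨x, ∇_x⟩ + t ∂_t)` tested against the constant `1`. -/
structure IsConeFunctional (μ γ : ℝ) (L : Poly d →ₗ[ℝ] ℝ) : Prop where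
  varX_mul (i : Fin d) (h : Poly d) :
    (2 * μ + 1) * L (varX i * h) = L (lorentz d * dX i h)
  varT_mul (h : Poly d) :
    (2 * μ + 1) * L (varT * (1 - varT) * h) - (γ + 1) * L (lorentz d * h)
      + L (lorentz d * (1 - varT) * dT h) = 0
  one : (2 * μ + d) * L 1 = (2 * μ + γ + d + 1) * L varT

namespace IsConeFunctional

variable {μ γ : ℝ} {L : Poly d →ₗ[ℝ] ℝ}

/-- Invariance under rotations: both sides are `(2μ + 1)⁻¹ L(s ∂_i ∂_j h)`. -/
theorem rotation (hL : IsConeFunctional μ γ L) (hμ : -(1 / 2) < μ) (i j : Fin d) (h : Poly d) :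
    L (varX i * dX j h) = L (varX j * dX i h) := by
  have h1 := hL.varX_mul i (dX j h)
  have h2 := hL.varX_mul j (dX i h)
  rw [dX_dX_comm i j, ← h2] at h1
  exact mul_left_cancel₀ (by linarith) h1

/-- Integration by parts along a boost: the mixed second derivatives coming from the two
coordinate directions cancel. -/
theorem boost (hL : IsConeFunctional μ γ L) (hμ : -(1 / 2) < μ) (i : Fin d) (h : Poly d) :
    L ((1 - varT) * boost i h) = (γ + 1) * L (varX i * h) := by
  have h1 := hL.varT_mul (dX i h)
  have h2 := hL.varX_mul i ((1 - varT) * dT h)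
  have h3 := hL.varX_mul i h
  have e1 : (1 - varT) * SolidCone.boost i h
      = varT * (1 - varT) * dX i h + varX i * ((1 - varT) * dT h) := by
    rw [SolidCone.boost]; ring
  have e2 : lorentz d * dX i ((1 - varT) * dT h) = lorentz d * (1 - varT) * dT (dX i h) := by
    rw [dX_mul, dT_dX_comm, map_sub, dX_one, dX_varT]; ring
  rw [e2] at h2
  rw [e1, map_add]
  refine mul_left_cancel₀ (show 2 * μ + 1 ≠ 0 by linarith) ?_
  linear_combination h1 + h2 - (γ + 1) * h3

/-- Integration by parts for the field `t ∂_{x_i} + x_i ∂_t - x_i (⟨x, ∇_x⟩ + t ∂_t)`, which is a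
combination of the boost `(1 - t) (t ∂_{x_i} + x_i ∂_t)`, of `s ∂_{x_i}` and of rotations. -/
theorem boost_sub_euler (hL : IsConeFunctional μ γ L) (hμ : -(1 / 2) < μ) (i : Fin d)
    (h : Poly d) :
    L (SolidCone.boost i h) - L (varX i * euler h)
      = (2 * μ + γ + d + 1) * L (varX i * h) := by
  have h1 := hL.boost hμ i h
  have h2 := hL.varX_mul i h
  -- Moving `x_j` inside the rotations costs `(d - 1) x_i h`, the part of the constant that
  -- depends on the dimension.
  have h3 : L (∑ j, (varX i * dX j (varX j * h) - varX j * dX i (varX j * h))) = 0 := by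
    rw [map_sum]
    refine Finset.sum_eq_zero fun j _ => ?_
    rw [map_sub, hL.rotation hμ i j, sub_self]
  have e1 : ∑ j, (varX i * dX j (varX j * h) - varX j * dX i (varX j * h))
      = C (d : ℝ) * (varX i * h) - varX i * h + varX i * xGrad h
        - (∑ j, varX j ^ 2) * dX i h := by
    have (j : Fin d) : varX i * dX j (varX j * h) - varX j * dX i (varX j * h)
        = varX i * h - (if i = j then varX i * h else 0) + varX i * (varX j * dX j h)
          - varX j ^ 2 * dX i h := by
      simp only [dX_mul, dX_varX, if_true]
      split_ifs with hij
      · subst hij; ring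
      · ring
    simp only [this, Finset.sum_sub_distrib, Finset.sum_add_distrib, Finset.sum_const,
      Finset.sum_ite_eq, Finset.mem_univ, if_true, xGrad, Finset.mul_sum, Finset.sum_mul,
      Finset.card_univ, Fintype.card_fin, nsmul_eq_mul, map_natCast]
  have e2 : SolidCone.boost i h = (1 - varT) * SolidCone.boost i h + lorentz d * dX i h
      - (C (d : ℝ) * (varX i * h) - varX i * h + varX i * xGrad h
        - (∑ j, varX j ^ 2) * dX i h)
      + varX i * euler h + C (d : ℝ) * (varX i * h) - varX i * h := by
    simp only [SolidCone.boost, lorentz, euler]; ring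
  rw [e1] at h3
  rw [e2]
  simp only [map_add, map_sub, linearMap_C_mul] at h3 ⊢
  linear_combination h1 - h2 - h3

/-- Since `t E = s ∂_t + ∑ x_i (t ∂_i + x_i ∂_t)`, integration by parts for `(1 - t) E` against a
multiple of `t` follows from the boosts. -/
theorem euler_varT_mul (hL : IsConeFunctional μ γ L) (hμ : -(1 / 2) < μ) (h : Poly d) :
    L ((1 - varT) * euler (varT * h)) + (2 * μ + d) * L (varT * h)
      - (2 * μ + γ + d + 1) * L (varT * (varT * h)) = 0 := by
  have h1 := hL.varT_mul h
  have h2 : L (∑ i, (1 - varT) * SolidCone.boost i (varX i * h))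
      = (γ + 1) * L ((∑ i, varX i ^ 2) * h) := by
    rw [map_sum, Finset.sum_mul, map_sum, Finset.mul_sum]
    refine Finset.sum_congr rfl fun i _ => ?_
    rw [hL.boost hμ]
    ring_nf
  have e1 : ∑ i, (1 - varT) * SolidCone.boost i (varX i * h)
      = C (d : ℝ) * ((1 - varT) * varT * h) + (1 - varT) * varT * xGrad h
        + (1 - varT) * (∑ i, varX i ^ 2) * dT h := by
    have (i : Fin d) : (1 - varT) * SolidCone.boost i (varX i * h)
        = (1 - varT) * varT * h + (1 - varT) * varT * (varX i * dX i h)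
          + (1 - varT) * varX i ^ 2 * dT h := by
      simp only [SolidCone.boost, dX_mul, dX_varX, dT_mul, dT_varX, if_true]
      ring
    simp only [this, Finset.sum_add_distrib, Finset.sum_const, xGrad, Finset.mul_sum,
      Finset.sum_mul, Finset.card_univ, Fintype.card_fin, nsmul_eq_mul, map_natCast]
  have e2 : (1 - varT) * euler (varT * h) = (1 - varT) * varT * h
      + lorentz d * (1 - varT) * dT h
      + (C (d : ℝ) * ((1 - varT) * varT * h) + (1 - varT) * varT * xGrad h
        + (1 - varT) * (∑ i, varX i ^ 2) * dT h)
      - C (d : ℝ) * ((1 - varT) * varT * h) := by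
    rw [euler_mul, euler_varT, euler, lorentz]; ring
  have e3 : lorentz d * h = varT * (varT * h) - (∑ i, varX i ^ 2) * h := by
    rw [lorentz]; ring
  have e4 : varT * (1 - varT) * h = varT * h - varT * (varT * h) := by ring
  have e5 : (1 - varT) * varT * h = varT * h - varT * (varT * h) := by ring
  rw [e1] at h2
  rw [e3, e4] at h1
  rw [e2]
  rw [e5] at h2 ⊢
  simp only [map_add, map_sub, linearMap_C_mul] at h1 h2 ⊢
  linear_combination h1 + h2

/-- Integration by parts for `(1 - t) E` against a multiple of `x_i`: the difference of
`boost_sub_euler` for `h` and for `t h`. -/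
theorem euler_varX_mul (hL : IsConeFunctional μ γ L) (hμ : -(1 / 2) < μ) (i : Fin d)
    (h : Poly d) :
    L ((1 - varT) * euler (varX i * h)) + (2 * μ + d) * L (varX i * h)
      - (2 * μ + γ + d + 1) * L (varT * (varX i * h)) = 0 := by
  have h1 := hL.boost_sub_euler hμ i h
  have h2 := hL.boost_sub_euler hμ i (varT * h)
  have h3 := hL.boost hμ i h
  have e1 : SolidCone.boost i (varT * h)
      = varX i * h - (1 - varT) * SolidCone.boost i h + SolidCone.boost i h := by
    rw [boost_mul]
    simp only [SolidCone.boost, dX_varT, dT_varT]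
    ring
  have e2 : varX i * euler (varT * h)
      = varT * (varX i * h) + varX i * euler h - (1 - varT) * euler (varX i * h)
        + varX i * h - varT * (varX i * h) := by
    rw [euler_mul, euler_mul, euler_varT, euler_varX]; ring
  have e3 : varX i * (varT * h) = varT * (varX i * h) := by ring
  rw [e1, e2, e3] at h2
  simp only [map_add, map_sub] at h1 h2 ⊢
  linear_combination h2 - h1 + h3

/-- Integration by parts for the field `(1 - t) (⟨x, ∇_x⟩ + t ∂_t)`. Against multiples of a
coordinate it follows from the boosts, so that only the constants need the identity `one`. -/
theorem euler (hL : IsConeFunctional μ γ L) (hμ : -(1 / 2) < μ) (g : Poly d) :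
    L ((1 - varT) * euler g) + (2 * μ + d) * L g
      - (2 * μ + γ + d + 1) * L (varT * g) = 0 := by
  induction g using MvPolynomial.induction_on with
  | C a =>
    have h1 := hL.one
    rw [← mul_one (C a), ← smul_eq_C_mul, euler_smul]
    simp only [euler_one, smul_zero, mul_zero, map_zero, map_smul, smul_eq_mul, mul_smul_comm,
      mul_one]
    linear_combination a * h1
  | add p q hp hq =>
    simp only [euler_add, mul_add, map_add] at hp hq ⊢
    linear_combination hp + hq
  | mul_X p j _ =>
    rw [mul_comm p]
    cases j with
    | none => exact hL.euler_varT_mul hμ p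
    | some i => exact hL.euler_varX_mul hμ i p

end IsConeFunctional

/-! ### Symmetry of the operator -/

/-- The carré du champ of the operator `diffOp`, i.e. the symmetric bilinear form in the first
derivatives given by its second order part. -/
def energy (p q : Poly d) : Poly d :=
  (1 - varT) * (varT * (dT p * dT q) + xGrad p * dT q + dT p * xGrad q)
    + varT * ∑ i, dX i p * dX i q - xGrad p * xGrad q

theorem energy_comm (p q : Poly d) : energy p q = energy q p := by
  simp only [energy, mul_comm (dX _ p)]
  ring

/-- The sum over pairs `i < j` in the operator, in terms of the sum over all pairs. -/
theorem sum_sum_Ioi (p : Poly d) :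
    2 * ∑ i, ∑ j ∈ Finset.Ioi i, varX i * varX j * dX i (dX j p)
      = ∑ i, ∑ j, varX i * varX j * dX i (dX j p) - ∑ i, varX i ^ 2 * dX i (dX i p) := by
  set f : Fin d → Fin d → Poly d := fun i j => varX i * varX j * dX i (dX j p) with hf
  have hs (i j : Fin d) : f i j = f j i := by
    simp only [hf]; rw [dX_dX_comm, mul_comm (varX i)]
  have h1 : ∑ i, ∑ j, f i j = ∑ i, (∑ j ∈ Finset.Ioi i, f i j) + ∑ i, f i i
      + ∑ i, ∑ j ∈ Finset.Iio i, f i j := by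
    rw [← Finset.sum_add_distrib, ← Finset.sum_add_distrib]
    refine Finset.sum_congr rfl fun i _ => ?_
    have hfil (s : Finset (Fin d)) : ∑ j ∈ s, f i j = ∑ j, if j ∈ s then f i j else 0 := by
      simp
    rw [hfil (Finset.Ioi i), hfil (Finset.Iio i),
      show f i i = ∑ j, if j = i then f i j else 0 by simp,
      ← Finset.sum_add_distrib, ← Finset.sum_add_distrib]
    refine Finset.sum_congr rfl fun j _ => ?_
    rcases lt_trichotomy i j with h | h | h
    · simp [h, h.ne', h.not_gt]
    · simp [h]
    · simp [h, h.ne, h.not_gt]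
  have h2 : ∑ i, ∑ j ∈ Finset.Iio i, f i j = ∑ i, ∑ j ∈ Finset.Ioi i, f i j := by
    rw [Finset.sum_comm' (t' := Finset.univ) (s' := fun j => Finset.Ioi j) (by simp)]
    exact Finset.sum_congr rfl fun i _ => Finset.sum_congr rfl fun j _ => hs j i
  have h3 : ∑ i, varX i ^ 2 * dX i (dX i p) = ∑ i, f i i :=
    Finset.sum_congr rfl fun i _ => by simp only [hf]; ring
  rw [h3]
  rw [h2] at h1
  linear_combination -h1

theorem xGrad_dT (p : Poly d) : dT (xGrad p) = xGrad (dT p) := by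
  simp only [xGrad, map_sum, dT_mul, dT_varX, dT_dX_comm, zero_mul, zero_add]

theorem xGrad_xGrad (p : Poly d) :
    ∑ i, varX i * xGrad (dX i p) = ∑ i, ∑ j, varX i * varX j * dX i (dX j p) := by
  simp only [xGrad, Finset.mul_sum]
  refine Finset.sum_congr rfl fun i _ => Finset.sum_congr rfl fun j _ => ?_
  rw [dX_dX_comm]; ring

theorem sum_sq_mul (p : Poly d) : ∑ i, (varT - varX i ^ 2) * dX i (dX i p)
    = varT * ∑ i, dX i (dX i p) - ∑ i, varX i ^ 2 * dX i (dX i p) := by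
  simp only [sub_mul, Finset.sum_sub_distrib, Finset.mul_sum]

/-- The operator without the sum over pairs `i < j`. -/
theorem diffOp_apply (μ γ : ℝ) (p : Poly d) :
    diffOp d μ γ p = varT * (1 - varT) * dT (dT p) + 2 * (1 - varT) * xGrad (dT p)
      + varT * ∑ i, dX i (dX i p) - ∑ i, ∑ j, varX i * varX j * dX i (dX j p)
      + C (2 * μ + d) * dT p - C (2 * μ + γ + d + 1) * SolidCone.euler p := by
  have h := sum_sum_Ioi p
  have h2 := sum_sq_mul p
  simp only [diffOp, LinearMap.coe_mk, AddHom.coe_mk, smul_eq_C_mul, SolidCone.euler] at *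
  linear_combination h2 - h

/-- Green's formula: the operator is the divergence, with respect to the weight, of the gradient
that `energy` defines. -/
theorem IsConeFunctional.diffOp_mul {μ γ : ℝ} {L : Poly d →ₗ[ℝ] ℝ}
    (hL : IsConeFunctional μ γ L) (hμ : -(1 / 2) < μ) (p q : Poly d) :
    L (diffOp d μ γ p * q) = -L (energy p q) := by
  have h1 := hL.euler hμ (q * dT p)
  have h2 : L (∑ i, (SolidCone.boost i (q * dX i p) - varX i * SolidCone.euler (q * dX i p)
      - C (2 * μ + γ + d + 1) * (varX i * (q * dX i p)))) = 0 := by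
    rw [map_sum]
    refine Finset.sum_eq_zero fun i _ => ?_
    rw [map_sub, map_sub, linearMap_C_mul]
    linear_combination hL.boost_sub_euler hμ i (q * dX i p)
  have e : diffOp d μ γ p * q + energy p q
      = (1 - varT) * SolidCone.euler (q * dT p) + C (2 * μ + d) * (q * dT p)
        - C (2 * μ + γ + d + 1) * (varT * (q * dT p))
        + ∑ i, (SolidCone.boost i (q * dX i p) - varX i * SolidCone.euler (q * dX i p)
          - C (2 * μ + γ + d + 1) * (varX i * (q * dX i p))) := by
    have (i : Fin d) : SolidCone.boost i (q * dX i p) - varX i * SolidCone.euler (q * dX i p)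
          - C (2 * μ + γ + d + 1) * (varX i * (q * dX i p))
        = varT * (dX i p * dX i q) + (varT * q) * dX i (dX i p)
          + ((1 - varT) * dT q - xGrad q) * (varX i * dX i p)
          + ((1 - varT) * q) * (varX i * dX i (dT p))
          - q * (varX i * xGrad (dX i p))
          - (C (2 * μ + γ + d + 1) * q) * (varX i * dX i p) := by
      rw [boost_mul, euler_mul]
      simp only [SolidCone.boost, SolidCone.euler, dT_dX_comm]
      ring
    simp only [this, Finset.sum_sub_distrib, Finset.sum_add_distrib, ← Finset.mul_sum]
    rw [xGrad_xGrad, diffOp_apply, energy, euler_mul]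
    simp only [SolidCone.euler]
    rw [← xGrad, ← xGrad]
    ring
  have := congrArg L e
  rw [map_add L, map_add L, map_sub L, map_add L, linearMap_C_mul, linearMap_C_mul, h2] at this
  linear_combination this + h1

theorem IsConeFunctional.diffOp_symm {μ γ : ℝ} {L : Poly d →ₗ[ℝ] ℝ}
    (hL : IsConeFunctional μ γ L) (hμ : -(1 / 2) < μ) (p q : Poly d) :
    L (diffOp d μ γ p * q) = L (p * diffOp d μ γ q) := by
  rw [hL.diffOp_mul hμ, energy_comm, ← hL.diffOp_mul hμ, mul_comm]

/-! ### Triangularity with respect to the degree -/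

/-- Euler's identity. -/
theorem euler_of_isHomogeneous {p : Poly d} {k : ℕ} (hp : p.IsHomogeneous k) :
    euler p = C (k : ℝ) * p := by
  have h := hp.sum_X_mul_pderiv
  rw [Fintype.sum_option, nsmul_eq_mul] at h
  rw [map_natCast, ← h, add_comm]
  rfl

theorem dX_isHomogeneous {p : Poly d} {k : ℕ} (i : Fin d) (hp : p.IsHomogeneous (k + 1)) :
    (dX i p).IsHomogeneous k := hp.pderiv

theorem dT_isHomogeneous {p : Poly d} {k : ℕ} (hp : p.IsHomogeneous (k + 1)) :
    (dT p).IsHomogeneous k := hp.pderiv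

theorem xGrad_isHomogeneous {p : Poly d} {k : ℕ} (hp : p.IsHomogeneous k) :
    (xGrad p).IsHomogeneous k := by
  cases k with
  | zero =>
    obtain ⟨a, rfl⟩ : ∃ a, p = C a :=
      ⟨_, totalDegree_eq_zero_iff_eq_C.1 ((totalDegree_zero_iff_isHomogeneous _).2 hp)⟩
    simpa [xGrad, dX_apply] using isHomogeneous_zero _ _ 0
  | succ k =>
    refine IsHomogeneous.sum _ _ _ fun i _ => ?_
    rw [add_comm]
    exact (isHomogeneous_X _ _).mul (dX_isHomogeneous i hp)

theorem diffOp_C (μ γ a : ℝ) : diffOp d μ γ (C a) = 0 := by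
  simp [diffOp_apply, euler, xGrad, dX_apply, dT_apply]

/-- The part of the operator preserving the degree acts by a scalar on homogeneous polynomials;
the rest lowers the degree by one. -/
theorem diffOp_add_of_isHomogeneous (μ γ : ℝ) {p : Poly d} {k : ℕ} (hp : p.IsHomogeneous (k + 1)) :
    (diffOp d μ γ p + C (((k + 1 : ℕ) : ℝ) * ((k + 1 : ℕ) + 2 * μ + γ + d)) * p).IsHomogeneous
      k := by
  have hE : euler p = C ((k + 1 : ℕ) : ℝ) * p := euler_of_isHomogeneous hp
  have hEE : euler (euler p) = C ((k + 1 : ℕ) : ℝ) * euler p := by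
    conv_lhs => rw [hE, ← smul_eq_C_mul, euler_smul, smul_eq_C_mul]
  -- The second order part of the operator that preserves the degree is `-(E² - E)`.
  have e1 : euler (euler p) = euler p + varT ^ 2 * dT (dT p) + 2 * varT * xGrad (dT p)
      + ∑ i, ∑ j, varX i * varX j * dX i (dX j p) := by
    have hx : xGrad (xGrad p) = xGrad p + ∑ i, ∑ j, varX i * varX j * dX i (dX j p) := by
      have h1 : ∑ i, xGrad (varX i * dX i p)
          = xGrad p + ∑ i, ∑ j, varX i * varX j * dX i (dX j p) := by
        rw [← xGrad_xGrad]
        simp only [xGrad_mul, Finset.sum_add_distrib]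
        congr 1
        refine Finset.sum_congr rfl fun i _ => ?_
        simp [xGrad]
      rw [← h1]
      conv_lhs => rw [xGrad.eq_1 p]
      simp only [xGrad, map_sum, Finset.mul_sum]
      exact Finset.sum_comm
    have hadd (a b : Poly d) : xGrad (a + b) = xGrad a + xGrad b := by
      simp only [xGrad, map_add, mul_add, Finset.sum_add_distrib]
    have hvT : xGrad (varT : Poly d) = 0 := by simp [xGrad]
    rw [euler, euler, hadd, xGrad_mul, map_add, dT_mul, xGrad_dT, dT_varT, hvT, hx]
    ring
  have key : diffOp d μ γ p + C (((k + 1 : ℕ) : ℝ) * ((k + 1 : ℕ) + 2 * μ + γ + d)) * p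
      = varT * dT (dT p) + 2 * xGrad (dT p) + varT * ∑ i, dX i (dX i p)
        + C (2 * μ + d) * dT p := by
    have e2 := e1
    rw [hEE, hE] at e2
    rw [diffOp_apply, hE]
    simp only [map_add, map_mul, map_one] at *
    linear_combination e2
  rw [key]
  -- For `k = 0` the subtraction truncates, but then the second derivatives vanish.
  have hX : (∑ i, dX i (dX i p)).IsHomogeneous (k - 1) :=
    IsHomogeneous.sum _ _ _ fun i _ => (dX_isHomogeneous i hp).pderiv
  have hT : (dT (dT p)).IsHomogeneous (k - 1) := (dT_isHomogeneous hp).pderiv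
  have hmul {q : Poly d} (hq : q.IsHomogeneous (k - 1)) (h0 : k = 0 → q = 0) :
      (varT * q).IsHomogeneous k := by
    rcases Nat.eq_zero_or_pos k with hk | hk
    · rw [h0 hk, mul_zero]; exact isHomogeneous_zero _ _ _
    · have := (isHomogeneous_X ℝ (none : Option (Fin d))).mul hq
      rwa [show 1 + (k - 1) = k by omega] at this
  have hconst {q : Poly d} (hq : q.IsHomogeneous k) (hk : k = 0) : ∃ a, q = C a := by
    subst hk
    exact ⟨_, totalDegree_eq_zero_iff_eq_C.1 ((totalDegree_zero_iff_isHomogeneous _).2 hq)⟩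
  refine (((hmul hT ?_).add ?_).add (hmul hX ?_)).add ((dT_isHomogeneous hp).C_mul _)
  · intro hk
    obtain ⟨a, ha⟩ := hconst (dT_isHomogeneous hp) hk
    rw [ha, dT_apply, pderiv_C]
  · exact (xGrad_isHomogeneous (dT_isHomogeneous hp)).C_mul 2
  · intro hk
    refine Finset.sum_eq_zero fun i _ => ?_
    obtain ⟨a, ha⟩ := hconst (dX_isHomogeneous i hp) hk
    rw [ha, dX_apply, pderiv_C]

/-- On polynomials of degree at most `n`, the operator is multiplication by a scalar up to
polynomials of lower degree. -/
theorem totalDegree_diffOp_add_le (μ γ : ℝ) {p : Poly d} {n : ℕ}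
    (hp : p.totalDegree ≤ n + 1) :
    (diffOp d μ γ p + C (((n + 1 : ℕ) : ℝ) * ((n + 1 : ℕ) + 2 * μ + γ + d)) * p).totalDegree
      ≤ n := by
  set ev : ℕ → ℝ := fun k => (k : ℝ) * (k + 2 * μ + γ + d) with hev
  have hsum : p = ∑ k ∈ Finset.range (n + 2), homogeneousComponent k p := by
    conv_lhs => rw [← sum_homogeneousComponent p]
    refine Finset.sum_subset (Finset.range_subset_range.2 (by omega)) fun k _ hk => ?_
    exact homogeneousComponent_eq_zero _ _ (by simpa using hk)
  have hsplit : diffOp d μ γ p + C (ev (n + 1)) * p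
      = ∑ k ∈ Finset.range (n + 2), ((diffOp d μ γ (homogeneousComponent k p)
          + C (ev k) * homogeneousComponent k p)
        + C (ev (n + 1) - ev k) * homogeneousComponent k p) := by
    conv_lhs => rw [hsum]
    rw [map_sum, Finset.mul_sum, ← Finset.sum_add_distrib]
    refine Finset.sum_congr rfl fun k _ => ?_
    rw [C_sub]; ring
  change (diffOp d μ γ p + C (ev (n + 1)) * p).totalDegree ≤ n
  rw [hsplit]
  refine totalDegree_finsetSum_le fun k hk => ?_
  have hhom := homogeneousComponent_isHomogeneous k p
  refine (totalDegree_add _ _).trans (max_le ?_ ?_)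
  · cases k with
    | zero =>
      rw [homogeneousComponent_zero, diffOp_C]
      simp [hev]
    | succ k =>
      have := (diffOp_add_of_isHomogeneous μ γ hhom).totalDegree_le
      have hk' := Finset.mem_range.1 hk
      exact this.trans (by omega)
  · rcases eq_or_ne k (n + 1) with rfl | hne
    · simp
    · refine (hhom.C_mul _).totalDegree_le.trans ?_
      have hk' := Finset.mem_range.1 hk
      omega

theorem totalDegree_diffOp_le (μ γ : ℝ) (p : Poly d) :
    (diffOp d μ γ p).totalDegree ≤ p.totalDegree := by
  rcases h : p.totalDegree with _ | n
  · rw [totalDegree_eq_zero_iff_eq_C.1 h, diffOp_C]; simp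
  · have h1 := totalDegree_diffOp_add_le μ γ h.le
    set c := ((n + 1 : ℕ) : ℝ) * ((n + 1 : ℕ) + 2 * μ + γ + d)
    have e : diffOp d μ γ p = (diffOp d μ γ p + C c * p) - C c * p := by ring
    rw [e]
    refine (totalDegree_sub _ _).trans (max_le (h1.trans (by omega)) ?_)
    rw [← smul_eq_C_mul]
    exact (totalDegree_smul_le _ _).trans h.le

/-- Orthogonality to lower degrees turns a symmetric operator that is triangular with respect to
the degree into a scalar: the remainder `D u + λ u` has degree less than `n` and is orthogonal
to itself. -/
theorem IsConeFunctional.diffOp_eq_of_orthogonal {μ γ : ℝ} {L : Poly d →ₗ[ℝ] ℝ}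
    (hL : IsConeFunctional μ γ L) (hμ : -(1 / 2) < μ) (hpos : ∀ v, L (v * v) = 0 → v = 0)
    {n : ℕ} {u : Poly d} (hu : u.totalDegree ≤ n)
    (horth : ∀ q : Poly d, q.totalDegree < n → L (u * q) = 0) :
    diffOp d μ γ u = (-((n : ℝ) * (n + 2 * μ + γ + d))) • u := by
  cases n with
  | zero =>
    rw [totalDegree_eq_zero_iff_eq_C.1 (Nat.le_zero.1 hu), diffOp_C]
    simp
  | succ n =>
    set c := ((n + 1 : ℕ) : ℝ) * ((n + 1 : ℕ) + 2 * μ + γ + d)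
    set v := diffOp d μ γ u + C c * u with hv
    have hdeg : v.totalDegree ≤ n := totalDegree_diffOp_add_le μ γ hu
    have h0 : L (v * v) = 0 := by
      have e : v * v = diffOp d μ γ u * v + C c * (u * v) := by
        conv_lhs => rw [hv, add_mul, mul_assoc]
      rw [e, map_add, linearMap_C_mul, hL.diffOp_symm hμ,
        horth _ ((totalDegree_diffOp_le μ γ v).trans_lt (by omega)), horth v (by omega)]
      simp
    have hv0 := hpos v h0
    rw [smul_eq_C_mul, C_neg]
    linear_combination hv0

end Algebra

section Analysis

open Set Real

/-! ### Integrability of the weight -/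

theorem intervalIntegrable_rpow_mul_one_sub_rpow {a b : ℝ} (ha : -1 < a) (hb : -1 < b) :
    IntervalIntegrable (fun t : ℝ => t ^ a * (1 - t) ^ b) volume 0 1 := by
  -- By the symmetry `t ↦ 1 - t` it suffices to treat the singularity at `0`.
  have key {a b : ℝ} (ha : -1 < a) :
      IntervalIntegrable (fun t : ℝ => t ^ a * (1 - t) ^ b) volume 0 (1 / 2) := by
    refine (intervalIntegral.intervalIntegrable_rpow' ha).mul_continuousOn ?_
    refine ContinuousOn.rpow_const (by fun_prop) fun t ht => Or.inl ?_
    rw [uIcc_of_le (by norm_num)] at ht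
    linarith [ht.2]
  refine (key ha).trans ?_
  have h := (key (b := a) hb).comp_sub_left 1
  norm_num at h
  simpa [mul_comm] using h.symm

/-- The recursion `a B(a, b) = (a + b) B(a + 1, b)` of the Beta integral. -/
theorem integral_beta_recursion {a b : ℝ} (ha : 0 < a) (hb : 0 < b) :
    ∫ t in (0 : ℝ)..1, (a - (a + b) * t) * (t ^ (a - 1) * (1 - t) ^ (b - 1)) = 0 := by
  have h := intervalIntegral.integral_eq_sub_of_hasDerivAt_of_le (a := (0 : ℝ)) (b := 1)
    (f := fun t => t ^ a * (1 - t) ^ b)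
    (f' := fun t => (a - (a + b) * t) * (t ^ (a - 1) * (1 - t) ^ (b - 1))) zero_le_one ?_ ?_ ?_
  · rw [h]; simp [ha.ne', hb.ne']
  · exact ((continuous_id.rpow_const fun _ => Or.inr ha.le).mul
      ((continuous_const.sub continuous_id).rpow_const fun _ => Or.inr hb.le)).continuousOn
  · intro t ht
    have h0 : 0 < t := ht.1
    have h1 : 0 < 1 - t := by linarith [ht.2]
    have h2 := ((hasDerivAt_id t).rpow_const (p := a) (Or.inl h0.ne')).mul
      (((hasDerivAt_id t).const_sub 1).rpow_const (p := b) (Or.inl h1.ne'))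
    refine h2.congr_deriv ?_
    have e1 : t ^ a = t ^ (a - 1) * t := by rw [← rpow_add_one h0.ne']; ring_nf
    have e2 : (1 - t) ^ b = (1 - t) ^ (b - 1) * (1 - t) := by
      rw [← rpow_add_one h1.ne']; ring_nf
    simp only [id_eq, e1, e2]
    ring
  · exact (intervalIntegrable_rpow_mul_one_sub_rpow (by linarith) (by linarith)).continuousOn_mul
      (by fun_prop)

/-- The factor `(t² - ‖x‖²)^a` of the weight on the slice of the cone at height `t`, a ball of
radius `t`, extended by zero. -/
def sliceWeight (a t : ℝ) (x : EuclideanSpace ℝ (Fin d)) : ℝ :=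
  if ‖x‖ ≤ t then (t ^ 2 - ‖x‖ ^ 2) ^ a else 0

/-- In polar coordinates the integrand is `r^(d - 1) (1 + r)^a (1 - r)^a`, whose only singularity
is integrable as `a > -1`. -/
theorem integrable_sliceWeight_one (hd : 1 ≤ d) {a : ℝ} (ha : -1 < a) :
    Integrable (sliceWeight (d := d) a 1) := by
  have : Nonempty (Fin d) := ⟨⟨0, hd⟩⟩
  have e : sliceWeight (d := d) a 1
      = fun x => (Iic 1).indicator (fun r : ℝ => (1 - r ^ 2) ^ a) ‖x‖ := by
    ext x
    simp [sliceWeight, indicator_apply]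
  rw [e, integrable_fun_norm_addHaar]
  have h : IntervalIntegrable (fun r : ℝ => (r ^ (Module.finrank ℝ (EuclideanSpace ℝ (Fin d)) - 1)
      * (1 + r) ^ a) * (1 - r) ^ a) volume 0 1 := by
    have h1 : IntervalIntegrable (fun r : ℝ => (1 - r) ^ a) volume 0 1 := by
      simpa using intervalIntegrable_rpow_mul_one_sub_rpow (a := 0) (by norm_num) ha
    refine h1.continuousOn_mul (ContinuousOn.mul (by fun_prop) ?_)
    refine ContinuousOn.rpow_const (by fun_prop) fun r hr => Or.inl ?_
    rw [uIcc_of_le zero_le_one] at hr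
    linarith [hr.1]
  rw [intervalIntegrable_iff_integrableOn_Ioc_of_le zero_le_one] at h
  rw [← integrable_indicator_iff measurableSet_Ioi]
  rw [← integrable_indicator_iff measurableSet_Ioc] at h
  refine h.congr (Filter.Eventually.of_forall fun r => ?_)
  by_cases h0 : 0 < r <;> by_cases h1 : r ≤ 1
  · simp only [indicator_apply, mem_Ioc, mem_Ioi, mem_Iic, h0, h1, and_self, if_true, smul_eq_mul]
    rw [mul_assoc, ← mul_rpow (by linarith) (by linarith)]
    ring_nf
  all_goals simp [indicator_apply, h0, h1]

/-- The slices of the weight are dilates of one another, up to a factor. -/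
theorem sliceWeight_eq_smul {a t : ℝ} (ht : 0 < t) :
    sliceWeight (d := d) a t = fun x => t ^ (2 * a) * sliceWeight a 1 (t⁻¹ • x) := by
  ext x
  have hmem : ‖t⁻¹ • x‖ ≤ 1 ↔ ‖x‖ ≤ t := by
    rw [norm_smul, norm_inv, Real.norm_of_nonneg ht.le, inv_mul_le_iff₀ ht, mul_one]
  by_cases hx : ‖x‖ ≤ t
  · have h1 := hmem.2 hx
    simp only [sliceWeight, hx, h1, if_true]
    have e : t ^ 2 - ‖x‖ ^ 2 = t ^ 2 * (1 ^ 2 - ‖t⁻¹ • x‖ ^ 2) := by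
      rw [norm_smul, norm_inv, Real.norm_of_nonneg ht.le]; field_simp
    rw [e, mul_rpow (by positivity) (by nlinarith [norm_nonneg (t⁻¹ • x)]), ← rpow_natCast t 2,
      ← rpow_mul ht.le]
    norm_num
  · have h1 := mt hmem.1 hx
    simp only [sliceWeight, hx, h1, if_false, mul_zero]

theorem integrable_sliceWeight (hd : 1 ≤ d) {a t : ℝ} (ha : -1 < a) (ht : 0 < t) :
    Integrable (sliceWeight (d := d) a t) := by
  rw [sliceWeight_eq_smul ht]
  exact ((integrable_sliceWeight_one hd ha).comp_smul (inv_ne_zero ht.ne')).const_mul _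

theorem integral_sliceWeight {a t : ℝ} (ht : 0 < t) :
    ∫ x, sliceWeight (d := d) a t x
      = t ^ (2 * a + d) * ∫ x, sliceWeight (d := d) a 1 x := by
  rw [sliceWeight_eq_smul ht, integral_const_mul, Measure.integral_comp_inv_smul_of_nonneg _ _ ht.le,
    finrank_euclideanSpace_fin, smul_eq_mul, ← mul_assoc, rpow_add ht, rpow_natCast]

theorem sliceWeight_nonneg {a t : ℝ} (x : EuclideanSpace ℝ (Fin d)) :
    0 ≤ sliceWeight a t x := by
  rw [sliceWeight]
  split_ifs with hx
  · exact rpow_nonneg (by nlinarith [norm_nonneg x]) _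
  · exact le_rfl

theorem isClosed_cone : IsClosed (cone d) :=
  (isClosed_le continuous_fst.norm continuous_snd).inter
    (isClosed_le continuous_snd continuous_const)

theorem measurableSet_cone : MeasurableSet (cone d) := isClosed_cone.measurableSet

theorem isCompact_cone : IsCompact (cone d) := by
  refine Metric.isCompact_of_isClosed_isBounded isClosed_cone ?_
  refine (Metric.isBounded_closedBall (x := (0 : EuclideanSpace ℝ (Fin d) × ℝ)) (r := 1)).subset ?_
  rintro ⟨x, t⟩ ⟨h1, h2⟩
  dsimp only at h1 h2
  rw [mem_closedBall_zero_iff, Prod.norm_mk, max_le_iff, Real.norm_eq_abs, abs_le]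
  have := norm_nonneg x
  exact ⟨h1.trans h2, by linarith, h2⟩

theorem measurable_weight (μ γ : ℝ) : Measurable (weight (d := d) μ γ) := by
  unfold weight
  fun_prop

theorem weight_nonneg {μ γ : ℝ} {z : EuclideanSpace ℝ (Fin d) × ℝ} (hz : z ∈ cone d) :
    0 ≤ weight μ γ z := by
  obtain ⟨h1, h2⟩ := hz
  have := norm_nonneg z.1
  exact mul_nonneg (rpow_nonneg (by nlinarith) _) (rpow_nonneg (by linarith) _)

theorem indicator_weight (μ γ : ℝ) {t : ℝ} (ht : 0 < t) (x : EuclideanSpace ℝ (Fin d)) :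
    (cone d).indicator (weight μ γ) (x, t)
      = (Ioc 0 1).indicator (fun t => (1 - t) ^ γ) t * sliceWeight (μ - 1 / 2) t x := by
  by_cases h1 : ‖x‖ ≤ t <;> by_cases h2 : t ≤ 1 <;>
    simp [cone, sliceWeight, weight, h1, h2, ht, mul_comm]

theorem indicator_weight_of_neg (μ γ : ℝ) {t : ℝ} (ht : t < 0) (x : EuclideanSpace ℝ (Fin d)) :
    (cone d).indicator (weight μ γ) (x, t) = 0 :=
  indicator_of_notMem (fun h => by linarith [norm_nonneg x, show ‖x‖ ≤ t from h.1]) _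

theorem integrableOn_weight (hd : 1 ≤ d) {μ γ : ℝ} (hμ : -(1 / 2) < μ) (hγ : -1 < γ) :
    IntegrableOn (weight (d := d) μ γ) (cone d) := by
  have hd' : (1 : ℝ) ≤ d := by exact_mod_cast hd
  rw [← integrable_indicator_iff measurableSet_cone, Measure.volume_eq_prod]
  have hne : ∀ᵐ t : ℝ, t ≠ 0 := by simp [ae_iff]
  rw [integrable_prod_iff'
    ((measurable_weight μ γ).indicator measurableSet_cone).aestronglyMeasurable]
  constructor
  · filter_upwards [hne] with t ht
    rcases lt_or_gt_of_ne ht with ht | ht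
    · simp [indicator_weight_of_neg μ γ ht]
    · simp only [indicator_weight μ γ ht]
      exact (integrable_sliceWeight hd (by linarith) ht).const_mul _
  · have h := (intervalIntegrable_rpow_mul_one_sub_rpow
      (show -1 < 2 * (μ - 1 / 2) + d by linarith) hγ).mul_const
        (∫ x, sliceWeight (d := d) (μ - 1 / 2) 1 x)
    rw [intervalIntegrable_iff_integrableOn_Ioc_of_le zero_le_one,
      ← integrable_indicator_iff measurableSet_Ioc] at h
    refine h.congr ?_
    filter_upwards [hne] with t ht
    rcases lt_or_gt_of_ne ht with ht | ht
    · simp [indicator_weight_of_neg μ γ ht, ht.le]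
    · simp only [indicator_weight μ γ ht, norm_mul, integral_const_mul,
        Real.norm_of_nonneg (sliceWeight_nonneg _), integral_sliceWeight ht]
      by_cases h1 : t ≤ 1
      · simp only [indicator_apply, mem_Ioc, ht, h1, and_self, if_true]
        rw [Real.norm_of_nonneg (rpow_nonneg (by linarith) _)]
        ring
      · simp [h1]

theorem continuous_evalAt (p : Poly d) : Continuous (evalAt p) := by
  refine (MvPolynomial.continuous_eval p).comp (continuous_pi fun j => ?_)
  cases j with
  | none => exact continuous_snd
  | some i => exact (EuclideanSpace.proj i).continuous.comp continuous_fst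

theorem integrableOn_evalAt_mul_weight (hd : 1 ≤ d) {μ γ : ℝ} (hμ : -(1 / 2) < μ) (hγ : -1 < γ)
    (p : Poly d) : IntegrableOn (fun z => evalAt p z * weight μ γ z) (cone d) :=
  (integrableOn_weight hd hμ hγ).continuousOn_mul (continuous_evalAt p).continuousOn isCompact_cone

/-! ### The moment functional and its positivity -/

/-- The functional `p ↦ ∫ p W` on polynomials. -/
def coneFunctional (hd : 1 ≤ d) {μ γ : ℝ} (hμ : -(1 / 2) < μ) (hγ : -1 < γ) :
    Poly d →ₗ[ℝ] ℝ where
  toFun p := ∫ z in cone d, evalAt p z * weight μ γ z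
  map_add' p q := by
    rw [← integral_add (integrableOn_evalAt_mul_weight hd hμ hγ p)
      (integrableOn_evalAt_mul_weight hd hμ hγ q)]
    simp only [evalAt, map_add, add_mul]
  map_smul' c p := by
    rw [RingHom.id_apply, smul_eq_mul, ← integral_const_mul]
    simp only [evalAt, MvPolynomial.smul_eval, mul_assoc]

theorem coneFunctional_apply (hd : 1 ≤ d) {μ γ : ℝ} (hμ : -(1 / 2) < μ) (hγ : -1 < γ)
    (p : Poly d) :
    coneFunctional hd hμ hγ p = ∫ z in cone d, evalAt p z * weight μ γ z := rfl

/-- A polynomial vanishing on the interior of the cone is zero. -/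
theorem eq_zero_of_evalAt_eq_zero {p : Poly d}
    (hp : ∀ z : EuclideanSpace ℝ (Fin d) × ℝ, ‖z.1‖ < z.2 → z.2 < 1 → evalAt p z = 0) :
    p = 0 := by
  -- With this `ε`, the box `(0, ε)^d × (1/2, 1)` lies inside the cone.
  set ε : ℝ := 1 / (2 * (d + 1)) with hε
  have hε0 : 0 < ε := by positivity
  refine MvPolynomial.funext_set (fun j => j.elim (Ioo (1 / 2 : ℝ) 1) fun _ => Ioo 0 ε) ?_ ?_
  · intro j
    cases j
    · exact Ioo_infinite (by norm_num)
    · exact Ioo_infinite hε0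
  · intro v hv
    rw [map_zero]
    have hT : v none ∈ Ioo (1 / 2 : ℝ) 1 := hv none trivial
    have hX (i : Fin d) : v (some i) ∈ Ioo 0 ε := hv (some i) trivial
    have hnorm : ‖WithLp.toLp 2 (fun i => v (some i))‖ ≤ 1 / 2 := by
      refine abs_le_of_sq_le_sq' ?_ (by norm_num) |>.2
      rw [EuclideanSpace.norm_sq_eq]
      calc ∑ i, ‖v (some i)‖ ^ 2 ≤ ∑ _i : Fin d, ε ^ 2 := by
            refine Finset.sum_le_sum fun i _ => ?_
            rw [Real.norm_of_nonneg (hX i).1.le]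
            exact pow_le_pow_left₀ (hX i).1.le (hX i).2.le 2
        _ = d * ε ^ 2 := by simp
        _ ≤ (1 / 2) ^ 2 := by
            have hd0 : (0 : ℝ) ≤ d := Nat.cast_nonneg d
            rw [hε, div_pow, div_pow, one_pow, mul_one_div, div_le_div_iff₀ (by positivity) (by norm_num)]
            nlinarith
    have := hp (WithLp.toLp 2 (fun i => v (some i)), v none) (hnorm.trans_lt hT.1) hT.2
    rw [← this, evalAt]
    congr 2
    ext j
    cases j <;> rfl

/-- Definiteness of the inner product: the weight is positive on the interior of the cone. -/
theorem coneFunctional_sq_eq_zero (hd : 1 ≤ d) {μ γ : ℝ} (hμ : -(1 / 2) < μ) (hγ : -1 < γ)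
    (v : Poly d) (hv : coneFunctional hd hμ hγ (v * v) = 0) : v = 0 := by
  set U : Set (EuclideanSpace ℝ (Fin d) × ℝ) := {z | ‖z.1‖ < z.2 ∧ z.2 < 1} with hU
  have hUo : IsOpen U :=
    (isOpen_lt continuous_fst.norm continuous_snd).inter
      (isOpen_lt continuous_snd continuous_const)
  have hUc : U ⊆ cone d := fun z hz => ⟨hz.1.le, hz.2.le⟩
  rw [coneFunctional_apply, setIntegral_eq_zero_iff_of_nonneg_ae ?_
    (integrableOn_evalAt_mul_weight hd hμ hγ _)] at hv
  · have h1 : (evalAt v) =ᵐ[volume.restrict U] fun _ => 0 := by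
      filter_upwards [ae_restrict_of_ae_restrict_of_subset hUc hv,
        ae_restrict_mem hUo.measurableSet] with z hz hzU
      have hpos : 0 < weight μ γ z :=
        mul_pos (rpow_pos_of_pos (by nlinarith [hzU.1, norm_nonneg z.1]) _)
          (rpow_pos_of_pos (by linarith [hzU.2]) _)
      have h := (mul_eq_zero.1 hz).resolve_right hpos.ne'
      rw [evalAt, map_mul, mul_self_eq_zero] at h
      exact h
    have h2 := Measure.eqOn_open_of_ae_eq h1 hUo (continuous_evalAt v).continuousOn
      continuousOn_const
    exact eq_zero_of_evalAt_eq_zero fun z h3 h4 => h2 (show z ∈ U from ⟨h3, h4⟩)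
  · filter_upwards [ae_restrict_mem measurableSet_cone] with z hz
    refine mul_nonneg ?_ (weight_nonneg hz)
    rw [evalAt, map_mul]
    exact mul_self_nonneg _

/-- The first moment in `t`. By the scaling of the slices it is a ratio of Beta integrals. -/
theorem coneFunctional_one (hd : 1 ≤ d) {μ γ : ℝ} (hμ : -(1 / 2) < μ) (hγ : -1 < γ) :
    (2 * μ + d) * coneFunctional (d := d) hd hμ hγ 1
      = (2 * μ + γ + d + 1) * coneFunctional hd hμ hγ varT := by
  have hd' : (1 : ℝ) ≤ d := by exact_mod_cast hd
  set p : Poly d := (2 * μ + d) • 1 - (2 * μ + γ + d + 1) • varT with hp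
  suffices h : coneFunctional hd hμ hγ p = 0 by
    rw [hp, map_sub, map_smul, map_smul, smul_eq_mul, smul_eq_mul] at h
    linarith
  have hint := integrableOn_evalAt_mul_weight hd hμ hγ p
  rw [← integrable_indicator_iff measurableSet_cone, Measure.volume_eq_prod] at hint
  rw [coneFunctional_apply, ← integral_indicator measurableSet_cone, Measure.volume_eq_prod,
    integral_prod_symm _ hint]
  have hne : ∀ᵐ t : ℝ, t ≠ 0 := by simp [ae_iff]
  set c := ∫ x, sliceWeight (d := d) (μ - 1 / 2) 1 x
  have hev (x : EuclideanSpace ℝ (Fin d)) (t : ℝ) :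
      evalAt p (x, t) = 2 * μ + d - (2 * μ + γ + d + 1) * t := by
    simp [evalAt, hp, varT]
  have hslice : (fun t : ℝ => ∫ x, (cone d).indicator (fun z => evalAt p z * weight μ γ z) (x, t))
      =ᵐ[volume] (Ioc 0 1).indicator fun t => c * ((2 * μ + d - ((2 * μ + d) + (γ + 1)) * t)
        * (t ^ (2 * μ + d - 1) * (1 - t) ^ (γ + 1 - 1))) := by
    filter_upwards [hne] with t ht
    simp only [indicator_mul_right, hev]
    rw [integral_const_mul]
    rcases lt_or_gt_of_ne ht with ht | ht
    · simp [indicator_weight_of_neg μ γ ht, ht.le]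
    · simp only [indicator_weight μ γ ht, integral_const_mul, integral_sliceWeight ht]
      by_cases h1 : t ≤ 1
      · simp only [indicator_apply, mem_Ioc, ht, h1, and_self, if_true]
        rw [show 2 * (μ - 1 / 2) + (d : ℝ) = 2 * μ + d - 1 by ring, add_sub_cancel_right]
        ring
      · simp [h1]
  rw [integral_congr_ae hslice, integral_indicator measurableSet_Ioc, integral_const_mul,
    ← intervalIntegral.integral_of_le zero_le_one,
    integral_beta_recursion (by linarith) (by linarith), mul_zero]

/-! ### Integration by parts along coordinate lines -/

theorem hasDerivAt_eval_update {σ : Type*} [DecidableEq σ] (p : MvPolynomial σ ℝ) (v : σ → ℝ)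
    (j : σ) (r : ℝ) :
    HasDerivAt (fun r => MvPolynomial.eval (Function.update v j r) p)
      (MvPolynomial.eval (Function.update v j r) (MvPolynomial.pderiv j p)) r := by
  induction p using MvPolynomial.induction_on with
  | C a => simpa using hasDerivAt_const r a
  | add p q hp hq =>
    simp only [map_add]
    exact hp.add hq
  | mul_X p k hp =>
    have hk : HasDerivAt (fun r => Function.update v j r k)
        (MvPolynomial.eval (Function.update v j r) (MvPolynomial.pderiv j (MvPolynomial.X k)))
        r := by
      rcases eq_or_ne k j with rfl | hkj
      · simp only [Function.update_self, MvPolynomial.pderiv_X_self, map_one]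
        exact hasDerivAt_id r
      · simpa [Function.update_of_ne hkj, MvPolynomial.pderiv_X_of_ne hkj]
          using hasDerivAt_const r (v k)
    have h := hp.mul hk
    simp only [MvPolynomial.eval_mul, MvPolynomial.eval_X, Derivation.leibniz, smul_eq_mul,
      map_add]
    refine h.congr_deriv ?_
    ring

theorem hasDerivAt_evalAt_dT (p : Poly d) (x : EuclideanSpace ℝ (Fin d)) (t : ℝ) :
    HasDerivAt (fun t => evalAt p (x, t)) (evalAt (dT p) (x, t)) t := by
  have e (q : Poly d) (t : ℝ) : evalAt q (x, t) = MvPolynomial.eval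
      (Function.update (fun j : Option (Fin d) => j.elim 0 fun i => x i) none t) q := by
    rw [evalAt]
    congr 2
    ext j
    cases j <;> simp
  simp only [e]
  exact hasDerivAt_eval_update p _ _ t

theorem hasDerivAt_evalAt_dX (p : Poly d) (i : Fin d) (x : Fin d → ℝ) (r t : ℝ) :
    HasDerivAt (fun r => evalAt p (WithLp.toLp 2 (Function.update x i r), t))
      (evalAt (dX i p) (WithLp.toLp 2 (Function.update x i r), t)) r := by
  have e (q : Poly d) (r : ℝ) : evalAt q (WithLp.toLp 2 (Function.update x i r), t)
      = MvPolynomial.eval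
        (Function.update (fun j : Option (Fin d) => j.elim t x) (some i) r) q := by
    rw [evalAt]
    congr 2
    ext j
    cases j <;> simp [Function.update_apply]
  simp only [e]
  exact hasDerivAt_eval_update p _ _ r

theorem norm_toLp_update_sq (i : Fin d) (x : Fin d → ℝ) (r : ℝ) :
    ‖WithLp.toLp 2 (Function.update x i r)‖ ^ 2
      = r ^ 2 + ‖WithLp.toLp 2 (Function.update x i 0)‖ ^ 2 := by
  have e (r : ℝ) : ‖WithLp.toLp 2 (Function.update x i r)‖ ^ 2
      = r ^ 2 + ∑ j ∈ Finset.univ.erase i, x j ^ 2 := by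
    rw [EuclideanSpace.norm_sq_eq, ← Finset.add_sum_erase _ _ (Finset.mem_univ i)]
    simp only [Function.update_self, Real.norm_eq_abs, sq_abs]
    congr 1
    refine Finset.sum_congr rfl fun j hj => ?_
    rw [Function.update_of_ne (Finset.ne_of_mem_erase hj)]
  rw [e r, e 0, zero_pow two_ne_zero, zero_add]

/-- An integrable function whose integral along every line in a coordinate direction vanishes has
vanishing integral. -/
theorem integral_eq_zero_of_update {g : EuclideanSpace ℝ (Fin d) → ℝ} (hg : Integrable g)
    (i : Fin d)
    (h : ∀ x : Fin d → ℝ, Integrable (fun r => g (WithLp.toLp 2 (Function.update x i r))) →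
      ∫ r, g (WithLp.toLp 2 (Function.update x i r)) = 0) :
    ∫ x, g x = 0 := by
  obtain ⟨m, rfl⟩ : ∃ m, d = m + 1 := ⟨d - 1, by have := i.2; omega⟩
  have hp1 := PiLp.volume_preserving_toLp (Fin (m + 1))
  have hp2 := (volume_preserving_piFinSuccAbove (fun _ : Fin (m + 1) => ℝ) i).symm
  have he1 := (MeasurableEquiv.toLp 2 (Fin (m + 1) → ℝ)).measurableEmbedding
  have he2 := (MeasurableEquiv.piFinSuccAbove (fun _ : Fin (m + 1) => ℝ) i).symm.measurableEmbedding
  have hint := (hp2.integrable_comp_emb he2).2 ((hp1.integrable_comp_emb he1).2 hg)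
  rw [← hp1.integral_comp he1, ← hp2.integral_comp he2, Measure.volume_eq_prod]
  rw [Measure.volume_eq_prod] at hint
  refine (integral_prod_symm _ hint).trans ?_
  refine integral_eq_zero_of_ae ?_
  filter_upwards [hint.prod_left_ae] with y hy
  have e (r : ℝ) : (MeasurableEquiv.piFinSuccAbove (fun _ : Fin (m + 1) => ℝ) i).symm (r, y)
      = Function.update (i.insertNth 0 y : Fin (m + 1) → ℝ) i r := by
    rw [Fin.update_insertNth]; rfl
  simp only [Function.comp_def, e] at hy ⊢
  exact h _ hy

theorem evalAt_lorentz (x : EuclideanSpace ℝ (Fin d)) (t : ℝ) :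
    evalAt (lorentz d) (x, t) = t ^ 2 - ‖x‖ ^ 2 := by
  simp [evalAt, lorentz, varT, varX, EuclideanSpace.norm_sq_eq]

theorem integral_indicator_Icc_eq_sub {a b : ℝ} (hab : a ≤ b) {f f' : ℝ → ℝ}
    (hf : Continuous f) (hf' : ∀ x ∈ Ioo a b, HasDerivAt f (f' x) x)
    (hint : Integrable ((Icc a b).indicator f')) :
    ∫ x, (Icc a b).indicator f' x = f b - f a := by
  rw [integrable_indicator_iff measurableSet_Icc] at hint
  rw [integral_indicator measurableSet_Icc, integral_Icc_eq_integral_Ioc,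
    ← intervalIntegral.integral_of_le hab]
  exact intervalIntegral.integral_eq_sub_of_hasDerivAt_of_le hab hf.continuousOn hf'
    ((intervalIntegrable_iff_integrableOn_Icc_of_le hab).2 hint)

/-- Integration by parts along the `t` direction: the function
`(t² - ‖x‖²)^(μ + 1/2) (1 - t)^(γ + 1) h` vanishes at both ends `t = ‖x‖` and `t = 1`. -/
theorem coneFunctional_varT_mul (hd : 1 ≤ d) {μ γ : ℝ} (hμ : -(1 / 2) < μ) (hγ : -1 < γ)
    (h : Poly d) :
    (2 * μ + 1) * coneFunctional hd hμ hγ (varT * (1 - varT) * h)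
      - (γ + 1) * coneFunctional hd hμ hγ (lorentz d * h)
      + coneFunctional hd hμ hγ (lorentz d * (1 - varT) * dT h) = 0 := by
  set p : Poly d := (2 * μ + 1) • (varT * (1 - varT) * h) - (γ + 1) • (lorentz d * h)
    + lorentz d * (1 - varT) * dT h with hp
  suffices hL : coneFunctional hd hμ hγ p = 0 by
    rw [hp, map_add, map_sub, map_smul, map_smul, smul_eq_mul, smul_eq_mul] at hL
    exact hL
  have hint := integrableOn_evalAt_mul_weight hd hμ hγ p
  rw [← integrable_indicator_iff measurableSet_cone, Measure.volume_eq_prod] at hint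
  rw [coneFunctional_apply, ← integral_indicator measurableSet_cone, Measure.volume_eq_prod,
    integral_prod _ hint]
  refine integral_eq_zero_of_ae ?_
  filter_upwards [hint.prod_right_ae] with x hx
  have hev (t : ℝ) : evalAt p (x, t) = (2 * μ + 1) * (t * (1 - t) * evalAt h (x, t))
      - (γ + 1) * ((t ^ 2 - ‖x‖ ^ 2) * evalAt h (x, t))
      + (t ^ 2 - ‖x‖ ^ 2) * (1 - t) * evalAt (dT h) (x, t) := by
    rw [← evalAt_lorentz]
    simp [evalAt, hp, varT]
  have hind : (fun t => (cone d).indicator (fun z => evalAt p z * weight μ γ z) (x, t))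
      = (Icc ‖x‖ 1).indicator fun t => evalAt p (x, t) * weight μ γ (x, t) := by
    classical
    ext t
    simp [indicator_apply, cone]
  rw [hind] at hx ⊢
  rcases le_or_gt ‖x‖ 1 with hx1 | hx1
  · refine (integral_indicator_Icc_eq_sub hx1 (f := fun t => (t ^ 2 - ‖x‖ ^ 2) ^ (μ + 1 / 2)
      * (1 - t) ^ (γ + 1) * evalAt h (x, t)) ?_ ?_ hx).trans ?_
    · refine (Continuous.mul ?_ ?_).mul ?_
      · exact Continuous.rpow_const (by fun_prop) fun _ => Or.inr (by linarith)
      · exact Continuous.rpow_const (by fun_prop) fun _ => Or.inr (by linarith)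
      · exact (continuous_evalAt h).comp (by fun_prop)
    · intro t ht
      have ht0 : 0 < t := (norm_nonneg x).trans_lt ht.1
      have hs : 0 < t ^ 2 - ‖x‖ ^ 2 := by nlinarith [ht.1, norm_nonneg x]
      have h1 : 0 < 1 - t := by linarith [ht.2]
      have hder := ((((hasDerivAt_pow 2 t).sub_const (‖x‖ ^ 2)).rpow_const
        (p := μ + 1 / 2) (Or.inl hs.ne')).mul
        (((hasDerivAt_id t).const_sub 1).rpow_const (p := γ + 1) (Or.inl h1.ne'))).mul
        (hasDerivAt_evalAt_dT h x t)
      refine hder.congr_deriv ?_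
      have e1 : (t ^ 2 - ‖x‖ ^ 2) ^ (μ + 1 / 2)
          = (t ^ 2 - ‖x‖ ^ 2) ^ (μ - 1 / 2) * (t ^ 2 - ‖x‖ ^ 2) := by
        rw [← rpow_add_one hs.ne']; ring_nf
      have e2 : (1 - t) ^ (γ + 1) = (1 - t) ^ γ * (1 - t) := rpow_add_one h1.ne' γ
      simp only [id_eq, weight, hev, Pi.mul_apply]
      rw [e2, show μ + 1 / 2 - 1 = μ - 1 / 2 by ring, add_sub_cancel_right, e1]
      push_cast
      ring
    · have e1 : (0 : ℝ) ^ (μ + 1 / 2) = 0 := zero_rpow (by linarith)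
      have e2 : (0 : ℝ) ^ (γ + 1) = 0 := zero_rpow (by linarith)
      simp only [sub_self, e1, e2]
      simp
  · simp [Icc_eq_empty hx1.not_ge]

/-- Integration by parts along the `x_i` direction: the function
`(t² - ‖x‖²)^(μ + 1/2) (1 - t)^γ h` vanishes on the lateral boundary of the cone. -/
theorem coneFunctional_varX_mul (hd : 1 ≤ d) {μ γ : ℝ} (hμ : -(1 / 2) < μ) (hγ : -1 < γ)
    (i : Fin d) (h : Poly d) :
    (2 * μ + 1) * coneFunctional hd hμ hγ (varX i * h)
      = coneFunctional hd hμ hγ (lorentz d * dX i h) := by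
  set p : Poly d := lorentz d * dX i h - (2 * μ + 1) • (varX i * h) with hp
  suffices hL : coneFunctional hd hμ hγ p = 0 by
    rw [hp, map_sub, map_smul, smul_eq_mul] at hL
    linarith
  have hint := integrableOn_evalAt_mul_weight hd hμ hγ p
  rw [← integrable_indicator_iff measurableSet_cone, Measure.volume_eq_prod] at hint
  rw [coneFunctional_apply, ← integral_indicator measurableSet_cone, Measure.volume_eq_prod,
    integral_prod_symm _ hint]
  refine integral_eq_zero_of_ae ?_
  filter_upwards [hint.prod_left_ae] with t ht
  refine integral_eq_zero_of_update ht i fun x hx => ?_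
  set q := ‖WithLp.toLp 2 (Function.update x i 0)‖ ^ 2 with hq
  set X : ℝ → EuclideanSpace ℝ (Fin d) := fun r => WithLp.toLp 2 (Function.update x i r) with hX
  have hnorm (r : ℝ) : ‖X r‖ ^ 2 = r ^ 2 + q := norm_toLp_update_sq i x r
  have hev (r : ℝ) : evalAt p (X r, t) = (t ^ 2 - (r ^ 2 + q)) * evalAt (dX i h) (X r, t)
      - (2 * μ + 1) * (r * evalAt h (X r, t)) := by
    rw [← hnorm r, ← evalAt_lorentz]
    simp [evalAt, hp, varX, hX]
  by_cases hcase : 0 ≤ t ∧ t ≤ 1 ∧ q ≤ t ^ 2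
  · obtain ⟨ht0, ht1, hqt⟩ := hcase
    -- The line meets the cone in the segment `[-c, c]`.
    set c := √(t ^ 2 - q) with hc
    have hc0 : 0 ≤ c := sqrt_nonneg _
    have hcsq : c ^ 2 = t ^ 2 - q := sq_sqrt (by linarith)
    have hind : (fun r => (cone d).indicator (fun z => evalAt p z * weight μ γ z) (X r, t))
        = (Icc (-c) c).indicator fun r => evalAt p (X r, t) * weight μ γ (X r, t) := by
      classical
      ext r
      have hiff : (X r, t) ∈ cone d ↔ r ∈ Icc (-c) c := by
        rw [mem_Icc, ← abs_le, ← sq_le_sq₀ (abs_nonneg r) hc0, sq_abs, hcsq]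
        change ‖X r‖ ≤ t ∧ t ≤ 1 ↔ _
        rw [← sq_le_sq₀ (norm_nonneg _) ht0, hnorm]
        constructor
        · rintro ⟨h1, -⟩; linarith
        · intro h1; exact ⟨by linarith, ht1⟩
      simp only [indicator_apply, hiff]
    change Integrable (fun r => (cone d).indicator (fun z => evalAt p z * weight μ γ z) (X r, t))
      at hx
    change ∫ r, (fun r => (cone d).indicator (fun z => evalAt p z * weight μ γ z) (X r, t)) r = 0
    rw [hind] at hx ⊢
    refine (integral_indicator_Icc_eq_sub (by linarith)
      (f := fun r => (t ^ 2 - (r ^ 2 + q)) ^ (μ + 1 / 2) * (1 - t) ^ γ * evalAt h (X r, t))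
      ?_ ?_ hx).trans ?_
    · refine (Continuous.mul ?_ continuous_const).mul ?_
      · exact Continuous.rpow_const (by fun_prop) fun _ => Or.inr (by linarith)
      · exact continuous_iff_continuousAt.2 fun r => (hasDerivAt_evalAt_dX h i x r t).continuousAt
    · intro r hr
      have hs : 0 < t ^ 2 - (r ^ 2 + q) := by nlinarith [hr.1, hr.2]
      have hder := (((((hasDerivAt_pow 2 r).add_const q).const_sub (t ^ 2)).rpow_const
        (p := μ + 1 / 2) (Or.inl hs.ne')).mul_const ((1 - t) ^ γ)).mul
        (show HasDerivAt (fun r => evalAt h (X r, t)) _ r from hasDerivAt_evalAt_dX h i x r t)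
      refine hder.congr_deriv ?_
      have e1 : (t ^ 2 - (r ^ 2 + q)) ^ (μ + 1 / 2)
          = (t ^ 2 - (r ^ 2 + q)) ^ (μ - 1 / 2) * (t ^ 2 - (r ^ 2 + q)) := by
        rw [← rpow_add_one hs.ne']; ring_nf
      simp only [weight, hev, hnorm]
      change _ * evalAt h (X r, t) + _ * evalAt (dX i h) (X r, t) = _
      rw [show μ + 1 / 2 - 1 = μ - 1 / 2 by ring, e1]
      push_cast
      ring
    · have e0 : (0 : ℝ) ^ (μ + 1 / 2) = 0 := zero_rpow (by linarith)
      have e1 : t ^ 2 - (c ^ 2 + q) = 0 := by linarith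
      simp only [even_two.neg_pow, e1, e0, zero_mul, sub_self]
  -- Otherwise the line misses the cone.
  · have hnot (r : ℝ) : (X r, t) ∉ cone d := by
      rintro ⟨h1, h2⟩
      refine hcase ⟨(norm_nonneg _).trans h1, h2, ?_⟩
      have := (sq_le_sq₀ (norm_nonneg _) ((norm_nonneg _).trans h1)).2 h1
      simp only [hnorm] at this
      nlinarith [sq_nonneg r]
    refine integral_eq_zero_of_ae (Filter.Eventually.of_forall fun r => ?_)
    exact indicator_of_notMem (hnot r) _

theorem isConeFunctional_coneFunctional (hd : 1 ≤ d) {μ γ : ℝ} (hμ : -(1 / 2) < μ)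
    (hγ : -1 < γ) : IsConeFunctional μ γ (coneFunctional (d := d) hd hμ hγ) where
  varX_mul := coneFunctional_varX_mul hd hμ hγ
  varT_mul := coneFunctional_varT_mul hd hμ hγ
  one := coneFunctional_one hd hμ hγ

theorem normConst_ne_zero (hd : 1 ≤ d) {μ γ : ℝ} (hμ : -(1 / 2) < μ) (hγ : -1 < γ) :
    normConst d μ γ ≠ 0 := by
  refine inv_ne_zero fun h => one_ne_zero (coneFunctional_sq_eq_zero hd hμ hγ 1 ?_)
  rw [coneFunctional_apply, ← h]
  simp [evalAt]

theorem innerProd_eq (hd : 1 ≤ d) {μ γ : ℝ} (hμ : -(1 / 2) < μ) (hγ : -1 < γ) (p q : Poly d) :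
    innerProd μ γ p q = normConst d μ γ * coneFunctional hd hμ hγ (p * q) := by
  simp only [innerProd, coneFunctional_apply, evalAt, map_mul]

end Analysis

end SolidCone

end

theorem mainTheorem1 (d : ℕ) (hd : 1 ≤ d) (μ γ : ℝ) (hμ : -(1 / 2) < μ) (hγ : -1 < γ) (n : ℕ)
    (u : SolidCone.Poly d) (hu : u ∈ SolidCone.orthogonalPolynomials d μ γ n) :
    SolidCone.diffOp d μ γ u = (-((n : ℝ) * (n + 2 * μ + γ + d))) • u := by
  refine (SolidCone.isConeFunctional_coneFunctional hd hμ hγ).diffOp_eq_of_orthogonal hμ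
    (SolidCone.coneFunctional_sq_eq_zero hd hμ hγ) hu.1 fun q hq => ?_
  have h := hu.2 q hq
  rw [SolidCone.innerProd_eq hd hμ hγ] at h
  exact (mul_eq_zero.1 h).resolve_left (SolidCone.normConst_ne_zero hd hμ hγ)
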